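/- A tree-like tableau is a Young diagram (in English notation) some of whose cells contain a point, such that: (1) the top left cell contains a point, called the root; (2) for each non-root point there is either a point above it in the same column or a point to its left in the same row, but not both; (3) no row and no column of the diagram is empty of points. Its size is its number of points, and $\mathcal T_n$ denotes the set of tree-like tableaux of size $n$. A corner of $T$ is a cell of the diagram such that neither the cell directly below it nor the cell directly to its right belongs to the diagram; it is occupied if it contains a point. Let $oc(T)$ be the number of occupied corners of $T$, let $a_{n,k}$ be the number of $T\in\mathcal T_n$ with $oc(T)=k$, and put $$P_0=1,\qquad P_n(x)=\sum_{T\in\mathcal T_n}x^{oc(T)}=\sum_{k\ge 0}a_{n,k}x^k\quad(n\ge 1).$$ Then: - For all $n\ge 2$ and $k\ge 1$, $\; k\,a_{n,k}=2k\,a_{n-1,k}+(n-2(k-1))\,a_{n-1,k-1}$. - For all $n\ge 1$, $\; P_n'=nP_{n-1}+2(1-x)P_{n-1}'$; moreover $P_n(1)=n!$ for all $n\ge 0$. - $(P_n)_{n\ge0}$ is the unique sequence of real polynomials with $P_0=1$ and, for all $n\ge1$, $P_n'=nP_{n-1}+2(1-x)P_{n-1}'$ and $P_n(1)=n!$. -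 For all $n\ge 2$, the variance of $oc(T)$ for $T$ uniformly random in $\mathcal T_n$ equals $\frac{n-2}{n}$. -/

import Mathlib

open Polynomial

/-- A tree-like tableau: a Young diagram (English convention, the cell `(i, j)` lies in row `i`,
counted from the top, and in column `j`, counted from the left) some of whose cells contain a
point. -/
@[ext]
structure TreeLikeTableau where
  /-- the underlying Young diagram -/
  shape : YoungDiagram
  /-- the cells that contain a point -/
  points : Finset (ℕ × ℕ)
  points_subset : points ⊆ shape.cells
  /-- the top left cell contains a point, the root point -/
  root_mem : ((0, 0) : ℕ × ℕ) ∈ points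
  /-- every other point has a point above it in its column or a point to its left in its row,
  but not both -/
  parent : ∀ i j : ℕ, (i, j) ∈ points → (i, j) ≠ (0, 0) →
    Xor (∃ i' < i, (i', j) ∈ points) (∃ j' < j, (i, j') ∈ points)
  /-- no row of the diagram is empty -/
  row_nonempty : ∀ i j : ℕ, (i, j) ∈ shape → ∃ j', (i, j') ∈ points
  /-- no column of the diagram is empty -/
  col_nonempty : ∀ i j : ℕ, (i, j) ∈ shape → ∃ i', (i', j) ∈ points

namespace TreeLikeTableau

/-- The size of a tree-like tableau is its number of points. -/
def size (T : TreeLikeTableau) : ℕ := T.points.card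

/-- A corner is a cell of the diagram whose bottom and right edges are both on the Southeast
border, that is, with no cell of the diagram directly below it or directly to its right. -/
def IsCorner (T : TreeLikeTableau) (c : ℕ × ℕ) : Prop :=
  c ∈ T.shape ∧ (c.1 + 1, c.2) ∉ T.shape ∧ (c.1, c.2 + 1) ∉ T.shape

open Classical in
/-- The number of occupied corners, i.e. of corners that contain a point. -/
noncomputable def oc (T : TreeLikeTableau) : ℕ := (T.points.filter T.IsCorner).card

theorem row_lt_size (T : TreeLikeTableau) {i j : ℕ} (h : (i, j) ∈ T.shape) : i < T.size := by
  have hsub : Finset.range (i + 1) ⊆ T.points.image Prod.fst := by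
    intro a ha
    have ha' : a ≤ i := Nat.lt_succ_iff.mp (Finset.mem_range.mp ha)
    obtain ⟨j', hj'⟩ := T.row_nonempty a j (T.shape.up_left_mem ha' le_rfl h)
    exact Finset.mem_image.mpr ⟨_, hj', rfl⟩
  have h1 := Finset.card_le_card hsub
  have h2 : (T.points.image Prod.fst).card ≤ T.points.card := Finset.card_image_le
  rw [Finset.card_range] at h1
  exact lt_of_lt_of_le (Nat.lt_succ_self i) (h1.trans h2)

theorem col_lt_size (T : TreeLikeTableau) {i j : ℕ} (h : (i, j) ∈ T.shape) : j < T.size := by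
  have hsub : Finset.range (j + 1) ⊆ T.points.image Prod.snd := by
    intro a ha
    have ha' : a ≤ j := Nat.lt_succ_iff.mp (Finset.mem_range.mp ha)
    obtain ⟨i', hi'⟩ := T.col_nonempty i a (T.shape.up_left_mem le_rfl ha' h)
    exact Finset.mem_image.mpr ⟨_, hi', rfl⟩
  have h1 := Finset.card_le_card hsub
  have h2 : (T.points.image Prod.snd).card ≤ T.points.card := Finset.card_image_le
  rw [Finset.card_range] at h1
  exact lt_of_lt_of_le (Nat.lt_succ_self j) (h1.trans h2)

theorem cells_subset (T : TreeLikeTableau) :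
    T.shape.cells ⊆ Finset.range T.size ×ˢ Finset.range T.size := by
  rintro ⟨i, j⟩ h
  have h' : (i, j) ∈ T.shape := by simpa using h
  exact Finset.mem_product.mpr
    ⟨Finset.mem_range.mpr (T.row_lt_size h'), Finset.mem_range.mpr (T.col_lt_size h')⟩

end TreeLikeTableau

/-- The set of the tree-like tableaux of size `n`. -/
abbrev TLT (n : ℕ) : Type := {T : TreeLikeTableau // T.size = n}

instance TLT.instFinite (n : ℕ) : Finite (TLT n) := by
  let B : Finset (ℕ × ℕ) := Finset.range n ×ˢ Finset.range n
  have hB : ∀ T : TLT n, T.1.shape.cells ⊆ B := by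
    rintro ⟨T, rfl⟩
    exact T.cells_subset
  let f : TLT n → B.powerset × B.powerset := fun T =>
    (⟨T.1.shape.cells, Finset.mem_powerset.mpr (hB T)⟩,
     ⟨T.1.points, Finset.mem_powerset.mpr (T.1.points_subset.trans (hB T))⟩)
  refine Finite.of_injective f ?_
  intro S T h
  have h1 : S.1.shape.cells = T.1.shape.cells := congrArg (fun p => p.1.1) h
  have h2 : S.1.points = T.1.points := congrArg (fun p => p.2.1) h
  exact Subtype.ext (TreeLikeTableau.ext (YoungDiagram.ext h1) h2)

noncomputable instance TLT.instFintype (n : ℕ) : Fintype (TLT n) := Fintype.ofFinite _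

/-- Every set of tree-like tableaux of size `n` is an event. -/
instance TLT.instMeasurableSpace (n : ℕ) : MeasurableSpace (TLT n) := ⊤

/-- `ocCount n k` is the number `a_{n,k}` of tree-like tableaux of size `n` with exactly `k`
occupied corners. -/
noncomputable def ocCount (n k : ℕ) : ℕ := Nat.card {T : TLT n // T.1.oc = k}

/-- The generating polynomial `P_n` of the number of occupied corners over the tree-like tableaux
of size `n` for `n ≥ 1`, with the convention `P_0 = 1`. -/
noncomputable def ocPoly (n : ℕ) : ℝ[X] :=
  if n = 0 then 1 else ∑ T : TLT n, (X : ℝ[X]) ^ T.1.oc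

/-! Everything follows from one weighted count, `sum_oc_mul`, obtained from a bijection. Inserting
under column `j` a row whose only point is its last cell creates an occupied corner with no point to
its left, and deleting that row undoes the insertion. Hence tableaux of size `m` with a chosen
column correspond to tableaux of size `m + 1` with a marked corner of this kind
(`sum_card_rowCorners`). The insertion keeps `oc` if column `j` already ended in an occupied corner,
and raises it by one otherwise. The occupied corners of the other kind are handled by transposition.
Adding the two counts, rows plus columns equal `m + 1` (`colLen_add_cols`), so the number of columns
drops out.

A second bijection, adding or removing an empty corner, shows that `oc` has mean 1 (`sum_oc`). Test
functions in `sum_oc_mul` then give all the claims: the constant 1 (with `sum_oc`) gives `n!`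
tableaux, an indicator the recurrence for the coefficients, `X ^ (k - 1)` that for the polynomials,
and the identity the second moment. -/

namespace YoungDiagram

/-! ### Young diagrams through their column lengths -/

/-- The Young diagram with prescribed column lengths. -/
def ofColLen (f : ℕ → ℕ) (hf : Antitone f) (N : ℕ) : YoungDiagram where
  -- The box only ensures finiteness: `f 0` bounds all columns, and `N` cuts nothing off once `f`
  -- vanishes from `N` on.
  cells := (Finset.range (f 0) ×ˢ Finset.range N).filter fun c => c.1 < f c.2
  isLowerSet := by
    rintro ⟨a, b⟩ ⟨r, s⟩ ⟨h1, h2⟩ h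
    simp only [Finset.coe_filter, Finset.mem_product, Finset.mem_range, Set.mem_ofPred_eq] at h h1 h2 ⊢
    have := hf h2
    omega

theorem mem_ofColLen {f : ℕ → ℕ} {hf : Antitone f} {N : ℕ} (hN : ∀ s, N ≤ s → f s = 0)
    {r s : ℕ} : (r, s) ∈ ofColLen f hf N ↔ r < f s := by
  rw [← mem_cells]
  simp only [ofColLen, Finset.mem_filter, Finset.mem_product, Finset.mem_range]
  have h0 := hf (Nat.zero_le s)
  have := hN s
  omega

theorem ext_colLen {μ ν : YoungDiagram} (h : ∀ s, μ.colLen s = ν.colLen s) : μ = ν := by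
  ext ⟨r, s⟩
  rw [mem_cells, mem_cells, mem_iff_lt_colLen, mem_iff_lt_colLen, h]

theorem colLen_eq_of_mem_iff {μ : YoungDiagram} {s k : ℕ} (h : ∀ r, (r, s) ∈ μ ↔ r < k) :
    μ.colLen s = k := by
  have h1 := h (μ.colLen s)
  have h2 := h k
  rw [mem_iff_lt_colLen] at h1 h2
  omega

theorem colLen_ofColLen {f : ℕ → ℕ} {hf : Antitone f} {N : ℕ} (hN : ∀ s, N ≤ s → f s = 0)
    (s : ℕ) : (ofColLen f hf N).colLen s = f s :=
  colLen_eq_of_mem_iff fun _ => mem_ofColLen hN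

theorem colLen_eq_zero_iff {μ : YoungDiagram} {s : ℕ} : μ.colLen s = 0 ↔ μ.rowLen 0 ≤ s := by
  have h1 := μ.mem_iff_lt_colLen (i := 0) (j := s)
  have h2 := μ.mem_iff_lt_rowLen (i := 0) (j := s)
  rw [h1] at h2
  omega

end YoungDiagram

/-! ### Renumbering rows around a given one -/

/-- The increasing enumeration of the natural numbers other than `i`. -/
def skip (i r : ℕ) : ℕ := if r < i then r else r + 1

theorem skip_ne (i r : ℕ) : skip i r ≠ i := by unfold skip; split_ifs <;> omega

theorem skip_lt_skip {i a b : ℕ} : skip i a < skip i b ↔ a < b := by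
  unfold skip; split_ifs <;> omega

theorem skip_inj {i a b : ℕ} : skip i a = skip i b ↔ a = b := by
  unfold skip; split_ifs <;> omega

theorem skip_of_lt {i r : ℕ} (h : r < i) : skip i r = r := if_pos h

theorem skip_of_le {i r : ℕ} (h : i ≤ r) : skip i r = r + 1 := if_neg (not_lt.mpr h)

theorem eq_or_exists_skip (i r : ℕ) : r = i ∨ ∃ a, r = skip i a := by
  rcases lt_trichotomy r i with h | h | h
  · exact .inr ⟨r, (skip_of_lt h).symm⟩
  · exact .inl h
  · exact .inr ⟨r - 1, by rw [skip_of_le (by omega)]; omega⟩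

/-- Shift the rows of a cell so as to avoid row `i`. -/
def skipRow (i : ℕ) : ℕ × ℕ ↪ ℕ × ℕ where
  toFun c := (skip i c.1, c.2)
  inj' := by
    rintro ⟨a, b⟩ ⟨c, d⟩ h
    simpa [skip_inj] using h

theorem skipRow_apply (i r s : ℕ) : skipRow i (r, s) = (skip i r, s) := rfl

namespace TreeLikeTableau

/-- The length of a column of the diagram. -/
abbrev colLen (T : TreeLikeTableau) (s : ℕ) : ℕ := T.shape.colLen s

/-- The number of columns of the diagram. -/
abbrev cols (T : TreeLikeTableau) : ℕ := T.shape.rowLen 0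

theorem mem_shape_iff (T : TreeLikeTableau) {r s : ℕ} : (r, s) ∈ T.shape ↔ r < T.colLen s :=
  T.shape.mem_iff_lt_colLen

theorem colLen_anti (T : TreeLikeTableau) {s t : ℕ} (h : s ≤ t) : T.colLen t ≤ T.colLen s :=
  T.shape.colLen_anti _ _ h

theorem lt_colLen_of_mem (T : TreeLikeTableau) {r s : ℕ} (h : (r, s) ∈ T.points) :
    r < T.colLen s :=
  T.mem_shape_iff.mp ((YoungDiagram.mem_cells _).mp (T.points_subset h))

theorem colLen_pos_iff (T : TreeLikeTableau) {s : ℕ} : 0 < T.colLen s ↔ s < T.cols := by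
  rw [Nat.pos_iff_ne_zero, Ne, YoungDiagram.colLen_eq_zero_iff, not_le]

theorem isCorner_iff (T : TreeLikeTableau) {r s : ℕ} :
    T.IsCorner (r, s) ↔ r + 1 = T.colLen s ∧ T.colLen (s + 1) ≤ r := by
  simp only [IsCorner, mem_shape_iff]
  omega

theorem ext_points {S T : TreeLikeTableau} (h : ∀ s, S.colLen s = T.colLen s)
    (h' : ∀ r s, (r, s) ∈ S.points ↔ (r, s) ∈ T.points) : S = T :=
  TreeLikeTableau.ext (YoungDiagram.ext_colLen h) (by ext ⟨r, s⟩; exact h' r s)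

/-! ### Row insertion -/

/-- The column lengths after the insertion of a row of length `j + 1` at the bottom of
column `j`. -/
theorem antitone_insert (T : TreeLikeTableau) (j : ℕ) :
    Antitone fun s => if s ≤ j then T.colLen s + 1 else T.colLen s := by
  intro s t h
  have := T.colLen_anti h
  simp only
  split_ifs <;> omega

/-- The points after the insertion of a row at the bottom of column `j`. -/
def insertPoints (T : TreeLikeTableau) (j : ℕ) : Finset (ℕ × ℕ) :=
  insert (T.colLen j, j) (T.points.map (skipRow (T.colLen j)))

/-- By `eq_or_exists_skip` a row is either the new one or a shifted old one, so this lemma and the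
next determine all points. -/
theorem skip_mem_insertPoints (T : TreeLikeTableau) {j r s : ℕ} :
    (skip (T.colLen j) r, s) ∈ T.insertPoints j ↔ (r, s) ∈ T.points := by
  simp only [insertPoints, Finset.mem_insert, Prod.mk.injEq, skip_ne, false_and, false_or]
  exact Finset.mem_map' (skipRow (T.colLen j)) (a := (r, s))

theorem row_mem_insertPoints (T : TreeLikeTableau) {j s : ℕ} :
    (T.colLen j, s) ∈ T.insertPoints j ↔ s = j := by
  simp only [insertPoints, Finset.mem_insert, Prod.mk.injEq, true_and, Finset.mem_map, Prod.exists,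
    skipRow_apply, skip_ne, false_and, and_false, exists_false, or_false]

theorem insert_colLen_eq_zero (T : TreeLikeTableau) {j : ℕ} (hj : j < T.cols) (s : ℕ)
    (hs : T.cols ≤ s) : (if s ≤ j then T.colLen s + 1 else T.colLen s) = 0 := by
  rw [if_neg (by omega), colLen, YoungDiagram.colLen_eq_zero_iff]
  exact hs

/-- Insert a row of length `j + 1`, with a point in its last cell only, at the bottom of
column `j`. -/
def insertRow (T : TreeLikeTableau) (j : ℕ) (hj : j < T.cols) : TreeLikeTableau where
  shape := YoungDiagram.ofColLen _ (T.antitone_insert j) T.cols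
  points := T.insertPoints j
  points_subset := by
    rintro ⟨r, s⟩ h
    rw [YoungDiagram.mem_cells, YoungDiagram.mem_ofColLen (T.insert_colLen_eq_zero hj)]
    rcases eq_or_exists_skip (T.colLen j) r with rfl | ⟨a, rfl⟩
    · rw [row_mem_insertPoints] at h
      subst h
      simp
    · rw [skip_mem_insertPoints] at h
      have h1 := T.lt_colLen_of_mem h
      have h2 := fun h : j ≤ s => T.colLen_anti h
      unfold skip
      split_ifs <;> omega
  root_mem := by
    have := skip_of_lt (T.colLen_pos_iff.mpr hj)
    have h := T.skip_mem_insertPoints (j := j).mpr T.root_mem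
    rwa [this] at h
  parent := by
    intro r s h h0
    rcases eq_or_exists_skip (T.colLen j) r with rfl | ⟨a, rfl⟩
    · rw [row_mem_insertPoints] at h
      subst h
      refine .inl ⟨?_, ?_⟩
      · obtain ⟨i', hi'⟩ := T.col_nonempty 0 s (T.mem_shape_iff.mpr (T.colLen_pos_iff.mpr hj))
        have hlt := T.lt_colLen_of_mem hi'
        exact ⟨i', hlt, by rwa [← skip_of_lt hlt, skip_mem_insertPoints]⟩
      · rintro ⟨j', hj', h'⟩
        rw [row_mem_insertPoints] at h'
        omega
    · rw [skip_mem_insertPoints] at h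
      have hne : (a, s) ≠ (0, 0) := by
        intro hh
        simp only [Prod.mk.injEq] at hh
        obtain ⟨rfl, rfl⟩ := hh
        exact h0 (by rw [skip_of_lt (T.colLen_pos_iff.mpr hj)])
      have key := T.parent a s h hne
      -- The only new point lies below all old points of its column, so no old point acquires a
      -- point above it.
      have h1 : (∃ i' < skip (T.colLen j) a, (i', s) ∈ T.insertPoints j) ↔
          ∃ i' < a, (i', s) ∈ T.points := by
        constructor
        · rintro ⟨i', hi', hp⟩
          rcases eq_or_exists_skip (T.colLen j) i' with rfl | ⟨b, rfl⟩
          · rw [row_mem_insertPoints] at hp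
            subst hp
            have := T.lt_colLen_of_mem h
            rw [skip_of_lt this] at hi'
            omega
          · exact ⟨b, skip_lt_skip.mp hi', T.skip_mem_insertPoints.mp hp⟩
        · rintro ⟨i', hi', hp⟩
          exact ⟨_, skip_lt_skip.mpr hi', T.skip_mem_insertPoints.mpr hp⟩
      simpa only [h1, skip_mem_insertPoints] using key
  row_nonempty := by
    intro r s h
    rw [YoungDiagram.mem_ofColLen (T.insert_colLen_eq_zero hj)] at h
    rcases eq_or_exists_skip (T.colLen j) r with rfl | ⟨a, rfl⟩
    · exact ⟨j, T.row_mem_insertPoints.mpr rfl⟩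
    · simp only [skip_mem_insertPoints]
      by_cases ha : a < T.colLen j
      · exact T.row_nonempty a j (T.mem_shape_iff.mpr ha)
      · refine T.row_nonempty a s (T.mem_shape_iff.mpr ?_)
        rw [skip_of_le (by omega)] at h
        split_ifs at h <;> omega
  col_nonempty := by
    intro r s h
    rw [YoungDiagram.mem_ofColLen (T.insert_colLen_eq_zero hj)] at h
    have h0 : 0 < T.colLen s := by
      split_ifs at h with hs
      · exact T.colLen_pos_iff.mpr (by omega)
      · omega
    obtain ⟨i', hi'⟩ := T.col_nonempty 0 s (T.mem_shape_iff.mpr h0)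
    exact ⟨_, T.skip_mem_insertPoints.mpr hi'⟩

theorem colLen_insertRow (T : TreeLikeTableau) {j : ℕ} (hj : j < T.cols) (s : ℕ) :
    (T.insertRow j hj).colLen s = if s ≤ j then T.colLen s + 1 else T.colLen s :=
  YoungDiagram.colLen_ofColLen (hf := T.antitone_insert j) (T.insert_colLen_eq_zero hj) s

theorem points_insertRow (T : TreeLikeTableau) {j : ℕ} (hj : j < T.cols) :
    (T.insertRow j hj).points = T.insertPoints j := rfl

theorem size_insertRow (T : TreeLikeTableau) {j : ℕ} (hj : j < T.cols) :
    (T.insertRow j hj).size = T.size + 1 := by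
  rw [size, points_insertRow, insertPoints, Finset.card_insert_of_notMem, Finset.card_map, size]
  simp [skipRow_apply, skip_ne]

/-! ### Row deletion, the inverse of insertion -/

/-- The occupied corners without a point to their left. -/
def IsRowCorner (T : TreeLikeTableau) (c : ℕ × ℕ) : Prop :=
  c ∈ T.points ∧ T.IsCorner c ∧ ∀ j' < c.2, (c.1, j') ∉ T.points

/-- The column lengths after the deletion of the row of a corner in column `j`. -/
theorem antitone_delete (T : TreeLikeTableau) {i j : ℕ} (h : T.IsCorner (i, j)) :
    Antitone fun s => if s ≤ j then T.colLen s - 1 else T.colLen s := by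
  intro s t hst
  rw [isCorner_iff] at h
  have := T.colLen_anti hst
  have := fun h : s ≤ j => T.colLen_anti h
  have := fun h : j + 1 ≤ t => T.colLen_anti h
  simp only
  split_ifs <;> omega

theorem delete_colLen_eq_zero (T : TreeLikeTableau) {j : ℕ} (s : ℕ)
    (hs : T.cols ≤ s) : (if s ≤ j then T.colLen s - 1 else T.colLen s) = 0 := by
  have : T.colLen s = 0 := YoungDiagram.colLen_eq_zero_iff.mpr hs
  split_ifs <;> omega

/-- The diagram stops to the right of a corner, and the definition excludes points to its left. So
deleting the row loses a single point. -/
theorem IsRowCorner.eq_of_mem {T : TreeLikeTableau} {i j s : ℕ} (h : T.IsRowCorner (i, j))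
    (hs : (i, s) ∈ T.points) : s = j := by
  have h1 := T.isCorner_iff.mp h.2.1
  have h2 := T.lt_colLen_of_mem hs
  rcases lt_trichotomy s j with h' | h' | h'
  · exact absurd hs (h.2.2 s h')
  · exact h'
  · have := T.colLen_anti (show j + 1 ≤ s from h')
    omega

/-- The points after the deletion of row `i`. -/
noncomputable def deletePoints (T : TreeLikeTableau) (i : ℕ) : Finset (ℕ × ℕ) :=
  T.points.preimage (skipRow i) (skipRow i).injective.injOn

theorem mem_deletePoints (T : TreeLikeTableau) {i r s : ℕ} :
    (r, s) ∈ T.deletePoints i ↔ (skip i r, s) ∈ T.points :=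
  Finset.mem_preimage

/-- Delete the row of an occupied corner that has no point to its left. -/
noncomputable def deleteRow (T : TreeLikeTableau) (i j : ℕ) (h : T.IsRowCorner (i, j)) (hi : i ≠ 0) :
    TreeLikeTableau where
  shape := YoungDiagram.ofColLen _ (T.antitone_delete h.2.1) T.cols
  points := T.deletePoints i
  points_subset := by
    rintro ⟨r, s⟩ hp
    rw [YoungDiagram.mem_cells, YoungDiagram.mem_ofColLen T.delete_colLen_eq_zero]
    replace hp := T.lt_colLen_of_mem (T.mem_deletePoints.mp hp)
    have h1 := T.isCorner_iff.mp h.2.1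
    have := fun h : s ≤ j => T.colLen_anti h
    have := fun h : j + 1 ≤ s => T.colLen_anti h
    unfold skip at hp
    split_ifs at hp ⊢ <;> omega
  root_mem := by
    rw [mem_deletePoints, skip_of_lt (by omega)]
    exact T.root_mem
  parent := by
    intro r s hp h0
    simp only [mem_deletePoints] at hp ⊢
    have hne : (skip i r, s) ≠ (0, 0) := by
      intro hh
      simp only [Prod.mk.injEq] at hh
      obtain ⟨hr, rfl⟩ := hh
      refine h0 ?_
      unfold skip at hr
      split_ifs at hr
      rw [hr]
    have key := T.parent _ _ hp hne
    have h1 : (∃ i' < skip i r, (i', s) ∈ T.points) ↔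
        ∃ i' < r, (skip i i', s) ∈ T.points := by
      constructor
      · rintro ⟨i', hi', hp'⟩
        rcases eq_or_exists_skip i i' with rfl | ⟨b, rfl⟩
        -- A point above in the deleted row would be the corner itself, but nothing lies below a
        -- corner.
        · obtain rfl := h.eq_of_mem hp'
          have h1 := T.isCorner_iff.mp h.2.1
          have h2 : skip i' r < T.colLen s := T.lt_colLen_of_mem hp
          omega
        · exact ⟨b, skip_lt_skip.mp hi', hp'⟩
      · rintro ⟨i', hi', hp'⟩
        exact ⟨_, skip_lt_skip.mpr hi', hp'⟩
    rwa [h1] at key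
  row_nonempty := by
    intro r s hs
    rw [YoungDiagram.mem_ofColLen T.delete_colLen_eq_zero] at hs
    simp only [mem_deletePoints]
    refine T.row_nonempty _ s (T.mem_shape_iff.mpr ?_)
    have h1 := T.isCorner_iff.mp h.2.1
    have := fun h : j + 1 ≤ s => T.colLen_anti h
    unfold skip
    split_ifs at hs ⊢ <;> omega
  col_nonempty := by
    intro r s hs
    rw [YoungDiagram.mem_ofColLen T.delete_colLen_eq_zero] at hs
    simp only [mem_deletePoints]
    have hr : r < T.colLen s := by split_ifs at hs <;> omega
    obtain ⟨i', hi'⟩ := T.col_nonempty r s (T.mem_shape_iff.mpr hr)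
    rcases eq_or_exists_skip i i' with rfl | ⟨b, rfl⟩
    · obtain rfl := h.eq_of_mem hi'
      -- The deleted corner is not the root and has no point to its left, so a point above it keeps
      -- the column nonempty.
      rcases T.parent _ _ hi' (by simp [hi]) with ⟨⟨i'', h1, h2⟩, -⟩ | ⟨⟨j', h1, h2⟩, -⟩
      · exact ⟨i'', by rwa [skip_of_lt h1]⟩
      · exact absurd h2 (h.2.2 j' h1)
    · exact ⟨b, hi'⟩

theorem colLen_deleteRow (T : TreeLikeTableau) {i j : ℕ} (h : T.IsRowCorner (i, j)) (hi : i ≠ 0)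
    (s : ℕ) : (T.deleteRow i j h hi).colLen s = if s ≤ j then T.colLen s - 1 else T.colLen s :=
  YoungDiagram.colLen_ofColLen (hf := T.antitone_delete h.2.1) T.delete_colLen_eq_zero s

theorem mem_deleteRow (T : TreeLikeTableau) {i j : ℕ} (h : T.IsRowCorner (i, j)) (hi : i ≠ 0)
    {r s : ℕ} : (r, s) ∈ (T.deleteRow i j h hi).points ↔ (skip i r, s) ∈ T.points :=
  T.mem_deletePoints

theorem isRowCorner_insertRow (T : TreeLikeTableau) {j : ℕ} (hj : j < T.cols) :
    (T.insertRow j hj).IsRowCorner (T.colLen j, j) := by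
  refine ⟨T.row_mem_insertPoints.mpr rfl, ?_, fun j' hj' h => ?_⟩
  · rw [isCorner_iff, colLen_insertRow, colLen_insertRow, if_pos le_rfl, if_neg (by omega)]
    exact ⟨rfl, T.colLen_anti (by omega)⟩
  · have := T.row_mem_insertPoints.mp h
    omega

/-- The corner was the bottom cell of its column, so reinsertion under column `j` puts the row back
at height `i`. -/
theorem colLen_deleteRow_self (T : TreeLikeTableau) {i j : ℕ} (h : T.IsRowCorner (i, j))
    (hi : i ≠ 0) : (T.deleteRow i j h hi).colLen j = i := by
  have h1 := T.isCorner_iff.mp h.2.1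
  rw [colLen_deleteRow, if_pos le_rfl]
  omega

theorem lt_cols_deleteRow (T : TreeLikeTableau) {i j : ℕ} (h : T.IsRowCorner (i, j))
    (hi : i ≠ 0) : j < (T.deleteRow i j h hi).cols := by
  rw [← colLen_pos_iff, colLen_deleteRow_self]
  omega

theorem insertRow_deleteRow (T : TreeLikeTableau) {i j : ℕ} (h : T.IsRowCorner (i, j))
    (hi : i ≠ 0) : (T.deleteRow i j h hi).insertRow j (T.lt_cols_deleteRow h hi) = T := by
  have hc := T.colLen_deleteRow_self h hi
  have h1 := T.isCorner_iff.mp h.2.1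
  refine ext_points (fun s => ?_) (fun r s => ?_)
  · rw [colLen_insertRow, colLen_deleteRow]
    have := fun h : s ≤ j => T.colLen_anti h
    split_ifs <;> omega
  · rw [points_insertRow]
    rcases eq_or_exists_skip ((T.deleteRow i j h hi).colLen j) r with rfl | ⟨a, rfl⟩
    · rw [row_mem_insertPoints, hc]
      exact ⟨fun hs => hs ▸ h.1, h.eq_of_mem⟩
    · rw [skip_mem_insertPoints, mem_deleteRow, hc]

theorem deleteRow_insertRow (T : TreeLikeTableau) {j : ℕ} (hj : j < T.cols)
    (hi : T.colLen j ≠ 0) :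
    (T.insertRow j hj).deleteRow (T.colLen j) j (T.isRowCorner_insertRow hj) hi = T := by
  refine ext_points (fun s => ?_) (fun r s => ?_)
  · rw [colLen_deleteRow, colLen_insertRow]
    split_ifs <;> omega
  · rw [mem_deleteRow, points_insertRow, skip_mem_insertPoints]

theorem size_deleteRow (T : TreeLikeTableau) {i j : ℕ} (h : T.IsRowCorner (i, j))
    (hi : i ≠ 0) : (T.deleteRow i j h hi).size + 1 = T.size := by
  rw [← size_insertRow _ (T.lt_cols_deleteRow h hi), insertRow_deleteRow]

end TreeLikeTableau

/-! ### Transposition and the two kinds of occupied corners -/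

namespace TreeLikeTableau

/-- The reflection of a tree-like tableau in the main diagonal. -/
def transpose (T : TreeLikeTableau) : TreeLikeTableau where
  shape := T.shape.transpose
  points := T.points.map (Equiv.prodComm ℕ ℕ).toEmbedding
  points_subset := by
    rintro ⟨r, s⟩ h
    rw [YoungDiagram.mem_cells, YoungDiagram.mem_transpose]
    simp only [Finset.mem_map_equiv, Equiv.prodComm_symm, Equiv.prodComm_apply] at h
    exact (YoungDiagram.mem_cells _).mp (T.points_subset h)
  root_mem := by simpa using T.root_mem
  parent := by
    intro r s h h0
    simp only [Finset.mem_map_equiv, Equiv.prodComm_symm, Equiv.prodComm_apply, Prod.swap] at h ⊢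
    exact (xor_comm _ _).mp (T.parent s r h (by simpa [and_comm] using h0))
  row_nonempty := by
    intro r s h
    rw [YoungDiagram.mem_transpose] at h
    simpa [Finset.mem_map_equiv] using T.col_nonempty s r h
  col_nonempty := by
    intro r s h
    rw [YoungDiagram.mem_transpose] at h
    simpa [Finset.mem_map_equiv] using T.row_nonempty s r h

theorem mem_transpose (T : TreeLikeTableau) {r s : ℕ} :
    (r, s) ∈ T.transpose.points ↔ (s, r) ∈ T.points := by
  simp [transpose, Finset.mem_map_equiv]

theorem transpose_transpose (T : TreeLikeTableau) : T.transpose.transpose = T :=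
  TreeLikeTableau.ext (YoungDiagram.transpose_transpose _)
    (by ext ⟨r, s⟩; rw [mem_transpose, mem_transpose])

theorem size_transpose (T : TreeLikeTableau) : T.transpose.size = T.size :=
  Finset.card_map _

theorem isCorner_transpose (T : TreeLikeTableau) {r s : ℕ} :
    T.transpose.IsCorner (r, s) ↔ T.IsCorner (s, r) := by
  simp only [IsCorner, transpose, YoungDiagram.mem_transpose, Prod.swap]
  tauto

open Classical in
theorem oc_transpose (T : TreeLikeTableau) : T.transpose.oc = T.oc := by
  refine Finset.card_nbij' Prod.swap Prod.swap ?_ ?_ ?_ ?_ <;> rintro ⟨r, s⟩ <;>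
    simp [mem_transpose, isCorner_transpose]

open Classical in
/-- The set of the occupied corners without a point to their left. -/
noncomputable def rowCorners (T : TreeLikeTableau) : Finset (ℕ × ℕ) :=
  T.points.filter T.IsRowCorner

theorem mem_rowCorners (T : TreeLikeTableau) {c : ℕ × ℕ} :
    c ∈ T.rowCorners ↔ T.IsRowCorner c := by
  simp only [rowCorners, Finset.mem_filter, IsRowCorner]
  tauto

/-- If the root is a corner, the diagram is a single cell. -/
theorem not_isCorner_root (T : TreeLikeTableau) (h : 2 ≤ T.size) : ¬ T.IsCorner (0, 0) := by
  intro hc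
  rw [isCorner_iff] at hc
  have hsub : T.points ⊆ {(0, 0)} := by
    rintro ⟨r, s⟩ hp
    have h1 := T.lt_colLen_of_mem hp
    have h2 := T.colLen_anti (Nat.zero_le s)
    have h3 := fun h : 0 + 1 ≤ s => T.colLen_anti h
    simp only [Finset.mem_singleton, Prod.mk.injEq]
    omega
  have := Finset.card_le_card hsub
  rw [Finset.card_singleton] at this
  unfold size at h
  omega

open Classical in
-- The exclusive alternative in `parent` puts each non-root occupied corner in exactly one of the
-- two kinds. The size bound keeps out the root, which would be counted twice.
theorem oc_eq_add (T : TreeLikeTableau) (h : 2 ≤ T.size) :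
    T.oc = T.rowCorners.card + T.transpose.rowCorners.card := by
  have hswap : T.transpose.rowCorners.card =
      (T.points.filter fun c => T.IsCorner c ∧ ∀ i' < c.1, (i', c.2) ∉ T.points).card := by
    refine Finset.card_nbij' Prod.swap Prod.swap ?_ ?_ ?_ ?_ <;> rintro ⟨r, s⟩ <;>
      simp [mem_rowCorners, IsRowCorner, mem_transpose, isCorner_transpose]
  rw [hswap, oc, rowCorners, ← Finset.card_union_of_disjoint]
  · congr 1
    ext ⟨r, s⟩
    simp only [Finset.mem_filter, Finset.mem_union, IsRowCorner]
    constructor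
    · rintro ⟨hp, hc⟩
      have h0 : (r, s) ≠ (0, 0) := by
        intro h'
        rw [h'] at hc
        exact T.not_isCorner_root h hc
      rcases T.parent r s hp h0 with ⟨-, h'⟩ | ⟨-, h'⟩
      · exact .inl ⟨hp, hp, hc, fun j' hj' hm => h' ⟨j', hj', hm⟩⟩
      · exact .inr ⟨hp, hc, fun j' hj' hm => h' ⟨j', hj', hm⟩⟩
    · tauto
  · rw [Finset.disjoint_left]
    rintro ⟨r, s⟩ h1 h2
    simp only [Finset.mem_filter, IsRowCorner] at h1 h2
    have h0 : (r, s) ≠ (0, 0) := by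
      intro h'
      rw [h'] at h2
      exact T.not_isCorner_root h h2.2.1
    rcases T.parent r s h1.1 h0 with ⟨⟨j', hj', hm⟩, -⟩ | ⟨⟨j', hj', hm⟩, -⟩
    · exact h2.2.2 j' hj' hm
    · exact h1.2.2.2 j' hj' hm

/-! ### Occupied corners under row insertion -/

open Classical in
/-- The columns whose bottom cell is an occupied corner. -/
noncomputable def ocCols (T : TreeLikeTableau) : Finset ℕ :=
  (T.points.filter T.IsCorner).image Prod.snd

theorem mem_ocCols (T : TreeLikeTableau) {s : ℕ} :
    s ∈ T.ocCols ↔ ∃ r, (r, s) ∈ T.points ∧ r + 1 = T.colLen s ∧ T.colLen (s + 1) ≤ r := by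
  simp [ocCols, isCorner_iff]

theorem card_ocCols (T : TreeLikeTableau) : T.ocCols.card = T.oc := by
  rw [ocCols, oc, Finset.card_image_of_injOn]
  rintro ⟨a, b⟩ h1 ⟨c, d⟩ h2 (rfl : b = d)
  simp only [Finset.coe_filter, Set.mem_ofPred_eq, isCorner_iff] at h1 h2
  rw [Prod.mk.injEq]
  omega

theorem ocCols_subset (T : TreeLikeTableau) : T.ocCols ⊆ Finset.range T.cols := by
  intro s hs
  obtain ⟨r, h, -⟩ := T.mem_ocCols.mp hs
  have := T.lt_colLen_of_mem h
  exact Finset.mem_range.mpr (T.colLen_pos_iff.mp (by omega))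

/-- Insertion moves rows but not columns, hence the indexing by columns. Corners left of column `j`
move down by one, those to its right stay, and the new point replaces any corner of column `j`. -/
theorem ocCols_insertRow (T : TreeLikeTableau) {j : ℕ} (hj : j < T.cols) :
    (T.insertRow j hj).ocCols = insert j T.ocCols := by
  ext s
  rw [Finset.mem_insert, mem_ocCols, mem_ocCols, colLen_insertRow, colLen_insertRow,
    points_insertRow]
  constructor
  · rintro ⟨r, hp, hr⟩
    by_cases hs : s = j
    · exact .inl hs
    rcases eq_or_exists_skip (T.colLen j) r with rfl | ⟨a, rfl⟩
    · exact .inl (T.row_mem_insertPoints.mp hp)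
    · refine .inr ⟨a, T.skip_mem_insertPoints.mp hp, ?_⟩
      have := fun h : s + 1 ≤ j => T.colLen_anti h
      have := fun h : j ≤ s => T.colLen_anti h
      unfold skip at hr
      split_ifs at hr <;> omega
  · rintro (rfl | ⟨r, hp, hr⟩)
    · refine ⟨_, T.row_mem_insertPoints.mpr rfl, ?_⟩
      rw [if_pos le_rfl, if_neg (by omega)]
      exact ⟨rfl, T.colLen_anti (by omega)⟩
    · by_cases hs : s = j
      · subst hs
        refine ⟨_, T.row_mem_insertPoints.mpr rfl, ?_⟩
        rw [if_pos le_rfl, if_neg (by omega)]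
        exact ⟨rfl, T.colLen_anti (by omega)⟩
      · refine ⟨_, T.skip_mem_insertPoints.mpr hp, ?_⟩
        have := fun h : s + 1 ≤ j => T.colLen_anti h
        have := fun h : j ≤ s => T.colLen_anti h
        unfold skip
        split_ifs <;> omega

theorem oc_insertRow (T : TreeLikeTableau) {j : ℕ} (hj : j < T.cols) :
    (T.insertRow j hj).oc = if j ∈ T.ocCols then T.oc else T.oc + 1 := by
  rw [← card_ocCols, ocCols_insertRow, ← card_ocCols]
  split_ifs with h
  · rw [Finset.insert_eq_of_mem h]
  · rw [Finset.card_insert_of_notMem h]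

/-! ### The half-perimeter -/

open Classical in
-- Each row contains a point, hence exactly one leftmost point.
theorem card_filter_leftmost (T : TreeLikeTableau) :
    (T.points.filter fun c => ∀ j' < c.2, (c.1, j') ∉ T.points).card = T.colLen 0 := by
  rw [← Finset.card_range (T.colLen 0)]
  refine Finset.card_bij (fun c _ => c.1) ?_ ?_ ?_
  · rintro ⟨r, s⟩ h
    have h1 := T.lt_colLen_of_mem (Finset.mem_filter.mp h).1
    have h2 := T.colLen_anti (Nat.zero_le s)
    exact Finset.mem_range.mpr (h1.trans_le h2)
  · rintro ⟨r, s⟩ h ⟨r', s'⟩ h' (rfl : r = r')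
    simp only [Finset.mem_filter] at h h'
    rcases lt_trichotomy s s' with hs | rfl | hs
    · exact absurd h.1 (h'.2 s hs)
    · rfl
    · exact absurd h'.1 (h.2 s' hs)
  · intro r hr
    have hex := T.row_nonempty r 0 (T.mem_shape_iff.mpr (Finset.mem_range.mp hr))
    exact ⟨(r, Nat.find hex),
      Finset.mem_filter.mpr ⟨Nat.find_spec hex, fun j' hj' => Nat.find_min hex hj'⟩, rfl⟩

theorem colLen_transpose (T : TreeLikeTableau) : T.transpose.colLen 0 = T.cols :=
  YoungDiagram.colLen_transpose _ _

theorem cols_transpose (T : TreeLikeTableau) : T.transpose.cols = T.colLen 0 :=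
  YoungDiagram.rowLen_transpose _ _

open Classical in
theorem card_filter_topmost (T : TreeLikeTableau) :
    (T.points.filter fun c => ∀ i' < c.1, (i', c.2) ∉ T.points).card = T.cols := by
  rw [← colLen_transpose, ← card_filter_leftmost]
  refine Finset.card_nbij' Prod.swap Prod.swap ?_ ?_ ?_ ?_ <;> rintro ⟨r, s⟩ <;>
    simp [mem_transpose]

open Classical in
/-- The half-perimeter of a tree-like tableau is its size plus one. -/
theorem colLen_add_cols (T : TreeLikeTableau) : T.colLen 0 + T.cols = T.size + 1 := by
  rw [← card_filter_leftmost, ← card_filter_topmost, ← Finset.card_union_add_card_inter]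
  -- By `parent`, every point is leftmost in its row or topmost in its column, and only the root is
  -- both.
  congr 1
  · rw [size]
    congr 1
    ext ⟨r, s⟩
    simp only [Finset.mem_union, Finset.mem_filter]
    constructor
    · tauto
    · intro hp
      by_cases h0 : (r, s) = (0, 0)
      · simp only [Prod.mk.injEq] at h0
        obtain ⟨rfl, rfl⟩ := h0
        exact .inl ⟨hp, fun j' hj' => absurd hj' (Nat.not_lt_zero _)⟩
      · rcases T.parent r s hp h0 with ⟨-, h'⟩ | ⟨-, h'⟩
        · exact .inl ⟨hp, fun j' hj' hm => h' ⟨j', hj', hm⟩⟩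
        · exact .inr ⟨hp, fun j' hj' hm => h' ⟨j', hj', hm⟩⟩
  · rw [Finset.card_eq_one]
    refine ⟨(0, 0), ?_⟩
    ext ⟨r, s⟩
    simp only [Finset.mem_inter, Finset.mem_filter, Finset.mem_singleton]
    constructor
    · rintro ⟨⟨hp, h1⟩, -, h2⟩
      by_contra h0
      rcases T.parent r s hp h0 with ⟨⟨j', hj', hm⟩, -⟩ | ⟨⟨j', hj', hm⟩, -⟩
      · exact h2 j' hj' hm
      · exact h1 j' hj' hm
    · intro h
      simp only [Prod.mk.injEq] at h
      obtain ⟨rfl, rfl⟩ := h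
      exact ⟨⟨T.root_mem, by simp⟩, T.root_mem, by simp⟩

/-- Row 0 already contains the root, so such a corner there would be the root. -/
theorem IsRowCorner.ne_zero {T : TreeLikeTableau} {i j : ℕ} (h : T.IsRowCorner (i, j))
    (hT : 2 ≤ T.size) : i ≠ 0 := by
  rintro rfl
  have := h.eq_of_mem T.root_mem
  subst this
  exact T.not_isCorner_root hT h.2.1

end TreeLikeTableau

/-! ### The weighted counting identity -/

open TreeLikeTableau

variable {R : Type*} [CommRing R]

theorem sum_transpose (n : ℕ) (f : TreeLikeTableau → R) :
    ∑ T : TLT n, f T.1.transpose = ∑ T : TLT n, f T.1 := by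
  let e : TLT n → TLT n := fun T => ⟨T.1.transpose, T.1.size_transpose.trans T.2⟩
  have he : Function.Involutive e := fun T => Subtype.ext T.1.transpose_transpose
  exact Equiv.sum_comp he.toPerm fun T : TLT n => f T.1

/-- Inserting a row is a bijection onto the tableaux with a marked occupied corner that has no
point to its left. -/
theorem sum_card_rowCorners (m : ℕ) (hm : 1 ≤ m) (f : ℕ → R) :
    ∑ T : TLT (m + 1), (T.1.rowCorners.card : R) * f T.1.oc =
      ∑ T : TLT m, ((T.1.oc : R) * f T.1.oc + ((T.1.cols : R) - T.1.oc) * f (T.1.oc + 1)) := by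
  -- The right side becomes a sum over the column chosen for insertion, each term being `f` at the
  -- resulting value of `oc`.
  have hR : ∀ T : TLT m,
      (T.1.oc : R) * f T.1.oc + ((T.1.cols : R) - T.1.oc) * f (T.1.oc + 1) =
      ∑ j ∈ Finset.range T.1.cols, f (if j ∈ T.1.ocCols then T.1.oc else T.1.oc + 1) := by
    intro T
    simp only [apply_ite f]
    rw [Finset.sum_ite, Finset.sum_const, Finset.sum_const, nsmul_eq_mul, nsmul_eq_mul,
      Finset.filter_mem_eq_inter, Finset.inter_eq_right.mpr T.1.ocCols_subset, card_ocCols,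
      Finset.filter_notMem_eq_sdiff, Finset.card_sdiff_of_subset T.1.ocCols_subset,
      Nat.cast_sub (Finset.card_le_card T.1.ocCols_subset), Finset.card_range, card_ocCols]
  rw [Finset.sum_congr rfl fun T _ => hR T]
  simp only [← nsmul_eq_mul, ← Finset.sum_const]
  rw [Finset.sum_sigma', Finset.sum_sigma']
  have h2 : ∀ T : TLT (m + 1), 2 ≤ T.1.size := fun T => by rw [T.2]; omega
  have hmem : ∀ a : (_ : TLT (m + 1)) × ℕ × ℕ, a ∈ Finset.univ.sigma (fun T => T.1.rowCorners) →
      a.1.1.IsRowCorner (a.2.1, a.2.2) := fun a ha =>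
    (mem_rowCorners _).mp (Finset.mem_sigma.mp ha).2
  have hlt : ∀ a : (_ : TLT m) × ℕ, a ∈ Finset.univ.sigma (fun T => Finset.range T.1.cols) →
      a.2 < a.1.1.cols := fun a ha => Finset.mem_range.mp (Finset.mem_sigma.mp ha).2
  refine Finset.sum_bij'
    (fun a ha => ⟨⟨a.1.1.deleteRow a.2.1 a.2.2 (hmem a ha) ((hmem a ha).ne_zero (h2 _)), by
      have := a.1.1.size_deleteRow (hmem a ha) ((hmem a ha).ne_zero (h2 _))
      rw [a.1.2] at this
      omega⟩, a.2.2⟩)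
    (fun a ha => ⟨⟨a.1.1.insertRow a.2 (hlt a ha), by rw [size_insertRow, a.1.2]⟩,
      a.1.1.colLen a.2, a.2⟩) ?_ ?_ ?_ ?_ ?_
  · intro a ha
    exact Finset.mem_sigma.mpr ⟨Finset.mem_univ _, Finset.mem_range.mpr
      (lt_cols_deleteRow _ (hmem a ha) ((hmem a ha).ne_zero (h2 _)))⟩
  · intro a ha
    exact Finset.mem_sigma.mpr
      ⟨Finset.mem_univ _, (mem_rowCorners _).mpr (isRowCorner_insertRow _ (hlt a ha))⟩
  · intro a ha
    refine Sigma.ext (Subtype.ext (insertRow_deleteRow _ (hmem a ha) ((hmem a ha).ne_zero (h2 _)))) (heq_of_eq ?_)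
    exact Prod.ext
      (colLen_deleteRow_self _ (hmem a ha) ((hmem a ha).ne_zero (h2 _))) rfl
  · intro a ha
    exact Sigma.ext (Subtype.ext (deleteRow_insertRow _ (hlt a ha) (colLen_pos_iff _ |>.mpr (hlt a ha)).ne')) HEq.rfl
  · intro a ha
    dsimp only
    have hi := (hmem a ha).ne_zero (h2 _)
    rw [← oc_insertRow _ (lt_cols_deleteRow _ (hmem a ha) hi), insertRow_deleteRow]

/-- The sum over the occupied corners of a function of their number. -/
theorem sum_oc_mul (m : ℕ) (hm : 1 ≤ m) (f : ℕ → R) :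
    ∑ T : TLT (m + 1), (T.1.oc : R) * f T.1.oc =
      ∑ T : TLT m, (2 * (T.1.oc : R) * f T.1.oc +
        ((m + 1 : ℕ) - 2 * (T.1.oc : R)) * f (T.1.oc + 1)) := by
  have h1 := sum_card_rowCorners m hm f
  have h2 := sum_transpose (m + 1) fun T => (T.rowCorners.card : R) * f T.oc
  have h3 := sum_transpose m fun T =>
    (T.oc : R) * f T.oc + ((T.cols : R) - T.oc) * f (T.oc + 1)
  simp only [oc_transpose, cols_transpose] at h2 h3
  calc _ = ∑ T : TLT (m + 1), (T.1.rowCorners.card : R) * f T.1.oc +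
        ∑ T : TLT (m + 1), (T.1.transpose.rowCorners.card : R) * f T.1.oc := by
        rw [← Finset.sum_add_distrib]
        refine Finset.sum_congr rfl fun T _ => ?_
        rw [← add_mul, ← Nat.cast_add, ← oc_eq_add]
        rw [T.2]; omega
    _ = _ := by
        rw [h2, h1]
        -- Only one of the two equal sums is transposed: its columns become rows, and together the
        -- coefficients contain the half-perimeter `m + 1`.
        nth_rw 1 [← h3]
        rw [← Finset.sum_add_distrib]
        refine Finset.sum_congr rfl fun T _ => ?_
        have := congrArg (Nat.cast (R := R)) (T.1.colLen_add_cols.trans (congrArg (· + 1) T.2))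
        rw [Nat.cast_add] at this
        rw [← this]
        ring

/-! ### Empty corners and the mean of `oc` -/

namespace TreeLikeTableau

/-- The columns whose bottom cell is a corner. -/
def cornerCols (T : TreeLikeTableau) : Finset ℕ :=
  (Finset.range T.cols).filter fun s => T.colLen (s + 1) < T.colLen s

/-- The columns, other than the first one, that are shorter than their left neighbour. -/
def addableCols (T : TreeLikeTableau) : Finset ℕ :=
  (Finset.range T.cols).filter fun s => s ≠ 0 ∧ T.colLen s < T.colLen (s - 1)

/-- The columns whose bottom cell is an empty corner. -/
noncomputable def emptyCols (T : TreeLikeTableau) : Finset ℕ := T.cornerCols \ T.ocCols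

theorem mem_cornerCols (T : TreeLikeTableau) {s : ℕ} :
    s ∈ T.cornerCols ↔ T.colLen (s + 1) < T.colLen s := by
  rw [cornerCols, Finset.mem_filter, Finset.mem_range, ← colLen_pos_iff]
  omega

theorem mem_addableCols (T : TreeLikeTableau) {s : ℕ} :
    s ∈ T.addableCols ↔ 0 < T.colLen s ∧ s ≠ 0 ∧ T.colLen s < T.colLen (s - 1) := by
  rw [addableCols, Finset.mem_filter, Finset.mem_range, ← colLen_pos_iff]

theorem mem_emptyCols (T : TreeLikeTableau) {s : ℕ} :
    s ∈ T.emptyCols ↔ T.colLen (s + 1) < T.colLen s ∧ (T.colLen s - 1, s) ∉ T.points := by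
  rw [emptyCols, Finset.mem_sdiff, mem_cornerCols, mem_ocCols]
  refine and_congr_right fun h => not_congr ?_
  constructor
  · rintro ⟨r, hp, hr, -⟩
    rwa [← hr]
  · intro hp
    exact ⟨_, hp, by omega, by omega⟩

theorem ocCols_subset_cornerCols (T : TreeLikeTableau) : T.ocCols ⊆ T.cornerCols := by
  intro s hs
  obtain ⟨r, -, h⟩ := T.mem_ocCols.mp hs
  rw [mem_cornerCols]
  omega

theorem colLen_pos (T : TreeLikeTableau) : 0 < T.colLen 0 := T.lt_colLen_of_mem T.root_mem

/-- A descent from column `s` to column `s + 1` gives a corner in the former and room for a cell in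
the latter, except when `s` is the last column. This exception is the 1. -/
theorem card_cornerCols (T : TreeLikeTableau) : T.cornerCols.card = T.addableCols.card + 1 := by
  have h0 : 0 < T.cols := T.colLen_pos_iff.mp T.colLen_pos
  have h1 : T.colLen (T.cols - 1) ≠ 0 := by
    have := (T.colLen_pos_iff (s := T.cols - 1)).mpr (by omega)
    omega
  have h2 : T.colLen T.cols = 0 := YoungDiagram.colLen_eq_zero_iff.mpr le_rfl
  have key : T.cornerCols = insert (T.cols - 1) (T.addableCols.image (· - 1)) := by
    ext s
    rw [Finset.mem_insert, Finset.mem_image, mem_cornerCols]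
    constructor
    · intro h
      by_cases hs : T.colLen (s + 1) = 0
      · left
        have h3 : T.cols ≤ s + 1 := YoungDiagram.colLen_eq_zero_iff.mp hs
        have h4 : s < T.cols := T.colLen_pos_iff.mp (by omega)
        omega
      · exact .inr ⟨s + 1, T.mem_addableCols.mpr ⟨by omega, by omega, h⟩, rfl⟩
    · rintro (rfl | ⟨t, ht, rfl⟩)
      · rw [Nat.sub_add_cancel h0, h2]
        omega
      · obtain ⟨h3, h4, h5⟩ := T.mem_addableCols.mp ht
        rwa [Nat.sub_add_cancel (by omega)]
  rw [key, Finset.card_insert_of_notMem, Finset.card_image_of_injOn]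
  · intro a ha b hb hab
    have := (T.mem_addableCols.mp ha).2.1
    have := (T.mem_addableCols.mp hb).2.1
    dsimp only at hab
    omega
  · rw [Finset.mem_image]
    rintro ⟨t, ht, h⟩
    obtain ⟨h3, h4, -⟩ := T.mem_addableCols.mp ht
    have := T.colLen_pos_iff.mp h3
    omega

theorem card_emptyCols_add_oc (T : TreeLikeTableau) :
    T.emptyCols.card + T.oc = T.addableCols.card + 1 := by
  rw [← card_cornerCols, ← card_ocCols, emptyCols]
  exact Finset.card_sdiff_add_card_eq_card T.ocCols_subset_cornerCols

theorem antitone_addCell (T : TreeLikeTableau) {j : ℕ} (h : j ∈ T.addableCols) :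
    Antitone fun s => if s = j then T.colLen s + 1 else T.colLen s := by
  intro s t hst
  have h1 := T.mem_addableCols.mp h
  have h2 := T.colLen_anti hst
  have h3 := fun h : s ≤ j - 1 => T.colLen_anti h
  simp only
  split_ifs with h4 h5 h5
  · subst h4 h5; omega
  · subst h4; omega
  · subst h5; omega
  · omega

theorem addCell_eq_zero (T : TreeLikeTableau) {j : ℕ} (h : j ∈ T.addableCols) (s : ℕ)
    (hs : T.cols ≤ s) : (if s = j then T.colLen s + 1 else T.colLen s) = 0 := by
  have h0 : T.colLen s = 0 := YoungDiagram.colLen_eq_zero_iff.mpr hs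
  have := T.mem_addableCols.mp h
  split_ifs with h1
  · subst h1
    omega
  · exact h0

theorem antitone_removeCell (T : TreeLikeTableau) {j : ℕ} (h : j ∈ T.emptyCols) :
    Antitone fun s => if s = j then T.colLen s - 1 else T.colLen s := by
  intro s t hst
  have h1 := (T.mem_emptyCols.mp h).1
  have h2 := T.colLen_anti hst
  have h3 := fun h : j + 1 ≤ t => T.colLen_anti h
  simp only
  split_ifs with h4 h5 h5
  · subst h4 h5; omega
  · subst h4; omega
  · subst h5; omega
  · omega

theorem removeCell_eq_zero (T : TreeLikeTableau) {j : ℕ} (s : ℕ)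
    (hs : T.cols ≤ s) : (if s = j then T.colLen s - 1 else T.colLen s) = 0 := by
  have h0 : T.colLen s = 0 := YoungDiagram.colLen_eq_zero_iff.mpr hs
  split_ifs <;> omega

/-- Add an empty cell at the bottom of a column. -/
def addCell (T : TreeLikeTableau) (j : ℕ) (h : j ∈ T.addableCols) : TreeLikeTableau where
  shape := YoungDiagram.ofColLen _ (T.antitone_addCell h) T.cols
  points := T.points
  points_subset := by
    rintro ⟨r, s⟩ hp
    rw [YoungDiagram.mem_cells, YoungDiagram.mem_ofColLen (T.addCell_eq_zero h)]
    have := T.lt_colLen_of_mem hp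
    split_ifs <;> omega
  root_mem := T.root_mem
  parent := T.parent
  row_nonempty := by
    intro r s hs
    rw [YoungDiagram.mem_ofColLen (T.addCell_eq_zero h)] at hs
    have h1 := T.mem_addableCols.mp h
    split_ifs at hs with h2
    · subst h2
      -- The left neighbour of the added cell already belongs to `T`, so no new row is started.
      exact T.row_nonempty r (s - 1) (T.mem_shape_iff.mpr (by omega))
    · exact T.row_nonempty r s (T.mem_shape_iff.mpr hs)
  col_nonempty := by
    intro r s hs
    rw [YoungDiagram.mem_ofColLen (T.addCell_eq_zero h)] at hs
    have h1 := T.mem_addableCols.mp h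
    split_ifs at hs with h2
    · subst h2
      exact T.col_nonempty 0 s (T.mem_shape_iff.mpr h1.1)
    · exact T.col_nonempty r s (T.mem_shape_iff.mpr hs)

/-- Remove the empty corner at the bottom of a column. -/
def removeCell (T : TreeLikeTableau) (j : ℕ) (h : j ∈ T.emptyCols) : TreeLikeTableau where
  shape := YoungDiagram.ofColLen _ (T.antitone_removeCell h) T.cols
  points := T.points
  points_subset := by
    rintro ⟨r, s⟩ hp
    rw [YoungDiagram.mem_cells, YoungDiagram.mem_ofColLen T.removeCell_eq_zero]
    have h1 := T.lt_colLen_of_mem hp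
    split_ifs with h2
    · subst h2
      have h3 := (T.mem_emptyCols.mp h).2
      have h4 : r ≠ T.colLen s - 1 := fun h => h3 (h ▸ hp)
      omega
    · exact h1
  root_mem := T.root_mem
  parent := T.parent
  row_nonempty := by
    intro r s hs
    rw [YoungDiagram.mem_ofColLen T.removeCell_eq_zero] at hs
    exact T.row_nonempty r s (T.mem_shape_iff.mpr (by split_ifs at hs <;> omega))
  col_nonempty := by
    intro r s hs
    rw [YoungDiagram.mem_ofColLen T.removeCell_eq_zero] at hs
    exact T.col_nonempty r s (T.mem_shape_iff.mpr (by split_ifs at hs <;> omega))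

theorem colLen_addCell (T : TreeLikeTableau) {j : ℕ} (h : j ∈ T.addableCols) (s : ℕ) :
    (T.addCell j h).colLen s = if s = j then T.colLen s + 1 else T.colLen s :=
  YoungDiagram.colLen_ofColLen (hf := T.antitone_addCell h) (T.addCell_eq_zero h) s

theorem colLen_removeCell (T : TreeLikeTableau) {j : ℕ} (h : j ∈ T.emptyCols) (s : ℕ) :
    (T.removeCell j h).colLen s = if s = j then T.colLen s - 1 else T.colLen s :=
  YoungDiagram.colLen_ofColLen (hf := T.antitone_removeCell h) T.removeCell_eq_zero s

theorem mem_emptyCols_addCell (T : TreeLikeTableau) {j : ℕ} (h : j ∈ T.addableCols) :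
    j ∈ (T.addCell j h).emptyCols := by
  rw [mem_emptyCols, colLen_addCell, colLen_addCell, if_neg (by omega), if_pos rfl]
  refine ⟨Nat.lt_succ_of_le (T.colLen_anti (by omega)), fun hp => ?_⟩
  have := T.lt_colLen_of_mem (show (T.colLen j + 1 - 1, j) ∈ T.points from hp)
  omega

/-- An empty corner in the first column would be alone in its row, and one in the first row alone in
its column; both are excluded by nonemptiness. -/
theorem mem_addableCols_removeCell (T : TreeLikeTableau) {j : ℕ} (h : j ∈ T.emptyCols) :
    j ∈ (T.removeCell j h).addableCols := by
  obtain ⟨h1, h2⟩ := T.mem_emptyCols.mp h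
  have h3 : j ≠ 0 := by
    rintro rfl
    obtain ⟨s, hs⟩ := T.row_nonempty (T.colLen 0 - 1) 0 (T.mem_shape_iff.mpr (by omega))
    have h4 := T.lt_colLen_of_mem hs
    rcases Nat.eq_zero_or_pos s with rfl | h5
    · exact h2 hs
    · have := T.colLen_anti (show 0 + 1 ≤ s from h5)
      omega
  have h4 : T.colLen j ≠ 1 := by
    intro h4
    obtain ⟨r, hr⟩ := T.col_nonempty 0 j (T.mem_shape_iff.mpr (by omega))
    have h5 := T.lt_colLen_of_mem hr
    have h6 : r = T.colLen j - 1 := by omega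
    exact h2 (h6 ▸ hr)
  rw [mem_addableCols, colLen_removeCell, colLen_removeCell, if_pos rfl, if_neg (by omega)]
  have := T.colLen_anti (show j - 1 ≤ j by omega)
  omega

theorem removeCell_addCell (T : TreeLikeTableau) {j : ℕ} (h : j ∈ T.addableCols) :
    (T.addCell j h).removeCell j (T.mem_emptyCols_addCell h) = T := by
  refine ext_points (fun s => ?_) fun _ _ => Iff.rfl
  rw [colLen_removeCell, colLen_addCell]
  split_ifs <;> omega

theorem addCell_removeCell (T : TreeLikeTableau) {j : ℕ} (h : j ∈ T.emptyCols) :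
    (T.removeCell j h).addCell j (T.mem_addableCols_removeCell h) = T := by
  refine ext_points (fun s => ?_) fun _ _ => Iff.rfl
  rw [colLen_addCell, colLen_removeCell]
  have := (T.mem_emptyCols.mp h).1
  split_ifs with hs
  · subst hs; omega
  · rfl

end TreeLikeTableau

/-- Removing a marked empty corner and adding an empty cell are mutually inverse and leave the
points, hence the size, unchanged. -/
theorem sum_card_emptyCols (n : ℕ) :
    ∑ T : TLT n, T.1.emptyCols.card = ∑ T : TLT n, T.1.addableCols.card := by
  rw [← Finset.card_sigma, ← Finset.card_sigma]
  refine Finset.card_bij'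
    (fun a ha => ⟨⟨a.1.1.removeCell a.2 (Finset.mem_sigma.mp ha).2, a.1.2⟩, a.2⟩)
    (fun a ha => ⟨⟨a.1.1.addCell a.2 (Finset.mem_sigma.mp ha).2, a.1.2⟩, a.2⟩) ?_ ?_ ?_ ?_
  · intro a ha
    exact Finset.mem_sigma.mpr ⟨Finset.mem_univ _, mem_addableCols_removeCell _ (Finset.mem_sigma.mp ha).2⟩
  · intro a ha
    exact Finset.mem_sigma.mpr ⟨Finset.mem_univ _, mem_emptyCols_addCell _ (Finset.mem_sigma.mp ha).2⟩
  · intro a ha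
    exact Sigma.ext (Subtype.ext (addCell_removeCell _ (Finset.mem_sigma.mp ha).2)) HEq.rfl
  · intro a ha
    exact Sigma.ext (Subtype.ext (removeCell_addCell _ (Finset.mem_sigma.mp ha).2)) HEq.rfl

/-- There is on average one occupied corner. -/
theorem sum_oc (n : ℕ) : ∑ T : TLT n, T.1.oc = Fintype.card (TLT n) := by
  have h := Finset.sum_congr (rfl : (Finset.univ : Finset (TLT n)) = Finset.univ)
    fun T _ => T.1.card_emptyCols_add_oc
  -- In the total, empty corners cancel against addable cells, leaving 1 per tableau.
  rw [Finset.sum_add_distrib, Finset.sum_add_distrib, sum_card_emptyCols] at h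
  simpa using h

/-! ### The number of tableaux -/

/-- The tableau with a single cell. -/
def singleCell : TreeLikeTableau where
  shape :=
    { cells := {(0, 0)}
      isLowerSet := by
        rintro ⟨a, b⟩ ⟨r, s⟩ ⟨h1, h2⟩ h
        simp_all }
  points := {(0, 0)}
  points_subset := subset_rfl
  root_mem := Finset.mem_singleton_self _
  parent := fun _ _ h h0 => absurd (Finset.mem_singleton.mp h) h0
  row_nonempty := fun _ j h => ⟨j, h⟩
  col_nonempty := fun i _ h => ⟨i, h⟩

theorem eq_singleCell (T : TreeLikeTableau) (h : T.size = 1) : T = singleCell := by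
  have hp : T.points = {(0, 0)} := by
    obtain ⟨c, hc⟩ := Finset.card_eq_one.mp h
    have h0 := T.root_mem
    rw [hc, Finset.mem_singleton] at h0
    rw [hc, ← h0]
  have key : ∀ S : TreeLikeTableau, S.size = 1 → ∀ r s, (r, s) ∈ S.shape ↔ r = 0 ∧ s = 0 := by
    intro S hS r s
    constructor
    · intro hm
      have := S.row_lt_size hm
      have := S.col_lt_size hm
      omega
    · rintro ⟨rfl, rfl⟩
      exact (YoungDiagram.mem_cells _).mp (S.points_subset S.root_mem)
  refine TreeLikeTableau.ext ?_ hp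
  ext ⟨r, s⟩
  rw [YoungDiagram.mem_cells, YoungDiagram.mem_cells, key T h, key singleCell rfl]

theorem card_TLT_one : Fintype.card (TLT 1) = 1 :=
  Fintype.card_eq_one_iff.mpr
    ⟨⟨singleCell, rfl⟩, fun T => Subtype.ext (eq_singleCell T.1 T.2)⟩

theorem oc_of_size_one (T : TLT 1) : T.1.oc = 1 := by
  have h := sum_oc 1
  have hs : Subsingleton (TLT 1) := Fintype.card_le_one_iff_subsingleton.mp card_TLT_one.le
  rwa [card_TLT_one, Fintype.sum_subsingleton _ T] at h

/-- The total of `oc` in size `m + 1` is computed twice: `sum_oc_mul` with the constant 1 gives `m +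
1` times the number of tableaux of size `m`, and `sum_oc` gives the number of size `m + 1`. -/
theorem card_TLT (n : ℕ) (hn : 1 ≤ n) : Fintype.card (TLT n) = n.factorial := by
  induction n, hn using Nat.le_induction with
  | base => exact card_TLT_one
  | succ m hm ih =>
    have h := sum_oc_mul (R := ℤ) m hm fun _ => 1
    simp only [mul_one, add_sub_cancel, Finset.sum_const, Finset.card_univ, nsmul_eq_mul, ih] at h
    have h2 := sum_oc (m + 1)
    zify at h2
    rw [h] at h2
    rw [Nat.factorial_succ, mul_comm]
    exact_mod_cast h2.symm

/-! ### Recurrences for the coefficients and the polynomials -/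

theorem ocCount_eq_sum (n k : ℕ) :
    (ocCount n k : R) = ∑ T : TLT n, if T.1.oc = k then 1 else 0 := by
  classical
  rw [Finset.sum_boole, ocCount, Nat.card_eq_fintype_card, Fintype.card_subtype]

theorem sum_mul_ite_oc (n k : ℕ) (g : ℕ → R) :
    ∑ T : TLT n, g T.1.oc * (if T.1.oc = k then 1 else 0) = g k * ocCount n k := by
  rw [ocCount_eq_sum, Finset.mul_sum]
  refine Finset.sum_congr rfl fun T _ => ?_
  split_ifs with h
  · rw [h]
  · simp

/-- This is `sum_oc_mul` for the indicator of `k + 1`; at `oc + 1` it selects `oc = k`. -/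
theorem ocCount_recurrence (m k : ℕ) (hm : 1 ≤ m) :
    ((k + 1 : ℕ) : R) * ocCount (m + 1) (k + 1) =
      2 * ((k + 1 : ℕ) : R) * ocCount m (k + 1) + (((m + 1 : ℕ) : R) - 2 * k) * ocCount m k := by
  have h := sum_oc_mul (R := R) m hm fun i => if i = k + 1 then 1 else 0
  simp only [Finset.sum_add_distrib, Nat.add_right_cancel_iff] at h
  rw [sum_mul_ite_oc (m + 1) (k + 1) fun i => (i : R),
    sum_mul_ite_oc m (k + 1) fun i => 2 * (i : R),
    sum_mul_ite_oc m k fun i => ((m + 1 : ℕ) : R) - 2 * (i : R)] at h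
  exact h

theorem ocPoly_zero : ocPoly 0 = 1 := if_pos rfl

theorem ocPoly_of_pos (n : ℕ) (hn : 1 ≤ n) : ocPoly n = ∑ T : TLT n, (X : ℝ[X]) ^ T.1.oc :=
  if_neg (by omega)

theorem coeff_ocPoly (n k : ℕ) (hn : 1 ≤ n) : (ocPoly n).coeff k = ocCount n k := by
  rw [ocPoly_of_pos n hn, finsetSum_coeff, ocCount_eq_sum]
  simp only [coeff_X_pow, eq_comm]

theorem eval_one_ocPoly (n : ℕ) : (ocPoly n).eval 1 = (n.factorial : ℝ) := by
  rcases Nat.eq_zero_or_pos n with rfl | hn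
  · simp [ocPoly_zero]
  · rw [ocPoly_of_pos n hn, eval_finsetSum, ← card_TLT n hn]
    simp

theorem derivative_ocPoly_succ (m : ℕ) :
    derivative (ocPoly (m + 1)) =
      ((m + 1 : ℕ) : ℝ[X]) * ocPoly m + 2 * (1 - X) * derivative (ocPoly m) := by
  have hd : ∀ n, 1 ≤ n → derivative (ocPoly n) =
      ∑ T : TLT n, (T.1.oc : ℝ[X]) * X ^ (T.1.oc - 1) := by
    intro n hn
    rw [ocPoly_of_pos n hn, derivative_sum]
    exact Finset.sum_congr rfl fun T _ => by rw [derivative_X_pow, C_eq_natCast]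
  -- `sum_oc_mul` starts at `m = 1`; for `m = 0` the convention `P_0 = 1` matches the derivative of
  -- `P_1 = X`.
  rcases Nat.eq_zero_or_pos m with rfl | hm
  · rw [hd 1 le_rfl, ocPoly_zero]
    simp [oc_of_size_one, card_TLT_one]
  · rw [hd _ (by omega), hd m hm, ocPoly_of_pos m hm, sum_oc_mul m hm fun k => X ^ (k - 1),
      Finset.mul_sum, Finset.mul_sum, ← Finset.sum_add_distrib]
    refine Finset.sum_congr rfl fun T _ => ?_
    -- The truncated exponent at `oc = 0` is harmless, as its coefficient vanishes.
    have hX : (T.1.oc : ℝ[X]) * X ^ T.1.oc = (T.1.oc : ℝ[X]) * X ^ (T.1.oc - 1) * X := by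
      rcases Nat.eq_zero_or_pos T.1.oc with h | h
      · simp [h]
      · rw [mul_assoc, ← pow_succ, Nat.sub_add_cancel h]
    rw [Nat.add_sub_cancel]
    linear_combination (-2) * hX

theorem eq_of_derivative_eq_of_eval_eq {p q : ℝ[X]} (h : derivative p = derivative q) (a : ℝ)
    (ha : p.eval a = q.eval a) : p = q := by
  have h0 : derivative (p - q) = 0 := by rw [derivative_sub, h, sub_self]
  have h1 := eq_C_of_derivative_eq_zero h0
  have h2 := congrArg (eval a) h1
  rw [eval_C, eval_sub, ha, sub_self] at h2
  rwa [← h2, C_0, sub_eq_zero] at h1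

/-! ### Second moment and variance -/

/-- With the identity as test function the quadratic terms in `sum_oc_mul` cancel, so the mean and
the number of tableaux of size `m` suffice. -/
theorem sum_oc_sq (m : ℕ) (hm : 1 ≤ m) :
    ∑ T : TLT (m + 1), (T.1.oc : ℝ) ^ 2 = 2 * m * m.factorial := by
  have h1 : ∑ T : TLT m, (T.1.oc : ℝ) = m.factorial := by
    rw [← card_TLT m hm, ← sum_oc m, Nat.cast_sum]
  have h := sum_oc_mul (R := ℝ) m hm fun k => k
  have h2 : ∀ T : TLT m, 2 * (T.1.oc : ℝ) * T.1.oc +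
      ((m + 1 : ℕ) - 2 * (T.1.oc : ℝ)) * (T.1.oc + 1 : ℕ) =
      ((m : ℝ) - 1) * T.1.oc + ((m : ℝ) + 1) := by
    intro T
    push_cast
    ring
  rw [Finset.sum_congr rfl fun T _ => h2 T, Finset.sum_add_distrib, ← Finset.mul_sum, h1,
    Finset.sum_const, Finset.card_univ, card_TLT m hm, nsmul_eq_mul] at h
  simp only [sq]
  rw [h]
  ring

theorem integral_uniformOn_univ {Ω : Type*} [Fintype Ω] [MeasurableSpace Ω]
    [MeasurableSingletonClass Ω] (f : Ω → ℝ) :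
    ∫ ω, f ω ∂(ProbabilityTheory.uniformOn (Set.univ : Set Ω)) =
      (∑ ω, f ω) / Fintype.card Ω := by
  rw [ProbabilityTheory.uniformOn, ProbabilityTheory.cond, MeasureTheory.Measure.restrict_univ,
    MeasureTheory.integral_smul_measure, MeasureTheory.integral_count,
    MeasureTheory.Measure.count_univ]
  simp [div_eq_inv_mul]

theorem variance_oc (n : ℕ) (hn : 2 ≤ n) :
    ProbabilityTheory.variance (fun T : TLT n => (T.1.oc : ℝ))
      (ProbabilityTheory.uniformOn (Set.univ : Set (TLT n))) = ((n : ℝ) - 2) / n := by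
  obtain ⟨m, rfl⟩ : ∃ m, n = m + 1 := ⟨n - 1, by omega⟩
  have hm : 1 ≤ m := by omega
  have hcard := card_TLT (m + 1) (by omega)
  have : Nonempty (TLT (m + 1)) := Fintype.card_pos_iff.mp (hcard ▸ Nat.factorial_pos _)
  have : MeasurableSingletonClass (TLT (m + 1)) := ⟨fun _ => trivial⟩
  have := ProbabilityTheory.isProbabilityMeasure_uniformOn
    (Set.finite_univ (α := TLT (m + 1))) Set.univ_nonempty
  rw [ProbabilityTheory.variance_eq_sub MeasureTheory.MemLp.of_discrete]
  simp only [Pi.pow_apply]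
  -- The second moment is `2m / (m + 1)` and the mean is 1.
  rw [integral_uniformOn_univ, integral_uniformOn_univ, sum_oc_sq m hm, ← Nat.cast_sum, sum_oc,
    hcard, Nat.factorial_succ]
  have h1 : (m.factorial : ℝ) ≠ 0 := Nat.cast_ne_zero.mpr (Nat.factorial_ne_zero m)
  have h2 : (m : ℝ) + 1 ≠ 0 := by positivity
  push_cast
  field_simp
  ring

theorem mainTheorem2 :
    -- `P_0 = 1`, and for `n ≥ 1` the coefficients of `P_n` are the numbers `a_{n,k}`
    ocPoly 0 = 1 ∧
    (∀ n : ℕ, 1 ≤ n → ocPoly n = ∑ T : TLT n, (X : ℝ[X]) ^ T.1.oc) ∧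
    (∀ n k : ℕ, 1 ≤ n → (ocPoly n).coeff k = (ocCount n k : ℝ)) ∧
    -- the recurrence for the coefficients
    (∀ n k : ℕ, 2 ≤ n → 1 ≤ k →
      (k : ℤ) * (ocCount n k : ℤ) =
        2 * (k : ℤ) * (ocCount (n - 1) k : ℤ)
          + ((n : ℤ) - 2 * ((k : ℤ) - 1)) * (ocCount (n - 1) (k - 1) : ℤ)) ∧
    -- the recurrence for the polynomials and their values at `1`
    (∀ n : ℕ, 1 ≤ n →
      derivative (ocPoly n) =
        (n : ℝ[X]) * ocPoly (n - 1) + 2 * (1 - X) * derivative (ocPoly (n - 1))) ∧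
    (∀ n : ℕ, (ocPoly n).eval 1 = (n.factorial : ℝ)) ∧
    -- these conditions determine the sequence
    (∀ Q : ℕ → ℝ[X], Q 0 = 1 →
      (∀ n : ℕ, 1 ≤ n →
        derivative (Q n) = (n : ℝ[X]) * Q (n - 1) + 2 * (1 - X) * derivative (Q (n - 1)) ∧
        (Q n).eval 1 = (n.factorial : ℝ)) →
      ∀ n : ℕ, Q n = ocPoly n) ∧
    -- the variance of `oc` for a uniformly random tree-like tableau of size `n`
    (∀ n : ℕ, 2 ≤ n →
      ProbabilityTheory.variance (fun T : TLT n => (T.1.oc : ℝ))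
        (ProbabilityTheory.uniformOn (Set.univ : Set (TLT n))) = ((n : ℝ) - 2) / n) := by
  refine ⟨ocPoly_zero, ocPoly_of_pos, fun n k hn => coeff_ocPoly n k hn, ?_, ?_,
    eval_one_ocPoly, ?_, variance_oc⟩
  · intro n k hn hk
    obtain ⟨m, rfl⟩ : ∃ m, n = m + 1 := ⟨n - 1, by omega⟩
    obtain ⟨l, rfl⟩ : ∃ l, k = l + 1 := ⟨k - 1, by omega⟩
    have h := ocCount_recurrence (R := ℤ) m l (by omega)
    simpa using h
  · intro n hn
    obtain ⟨m, rfl⟩ : ∃ m, n = m + 1 := ⟨n - 1, by omega⟩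
    exact derivative_ocPoly_succ m
  · intro Q h0 hQ n
    induction n with
    | zero => rw [h0, ocPoly_zero]
    | succ m ih =>
      obtain ⟨h1, h2⟩ := hQ (m + 1) (by omega)
      -- The derivative leaves only a constant free, and the value at 1 fixes it.
      refine eq_of_derivative_eq_of_eval_eq ?_ 1 (h2.trans (eval_one_ocPoly _).symm)
      rw [h1, derivative_ocPoly_succ, Nat.add_sub_cancel, ih]
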